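/- Let $\varphi=\frac{1+\sqrt5}{2}$ be the golden ratio and $\mathbb{N}=\{0,1,2,\dots\}$. A polynomial $P$ is called integer-valued if $P(n)\in\mathbb{Z}$ for all $n\in\mathbb{N}$. For every $\varepsilon>0$ there are infinitely many integer-valued polynomials $P$ that satisfy $$|P(n)|\le\left(\sqrt{2\varphi}+\varepsilon\right)\varphi^n\quad\text{for all } n\in\mathbb{N}.$$ -/

import Mathlib

/-- A polynomial is integer-valued if it takes integer values at all natural numbers
`0, 1, 2, …`. -/
def IsIntegerValued (P : Polynomial ℝ) : Prop :=
  ∀ n : ℕ, ∃ m : ℤ, P.eval (n : ℝ) = (m : ℝ)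

/-!
Put `α = φ⁻¹`. The discrete Laguerre functions with pole `α` arise by iterating an all-pass
filter, a contraction of `ℓ²` on every initial segment. Writing `α ^ n * (n choose k)` in terms of
them, with coefficients from a unitriangular Pascal matrix, produces a factor
`((1 - α ^ 2) / α) ^ k`, which is `1` exactly for the golden ratio. So for
`P = ∑ k < m, a k * (X choose k)` the numbers `φ ^ (-n) * P n / √φ` are the values at `a` of linear
forms `u n` on a unimodular lattice, with `‖u n‖ ≤ 1` and `∑ n, ‖u n‖ ^ 2 ≤ m`.

Such a system has at least `exp (m / 100)` lattice points at which every form is at most `√2` in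
absolute value. Indeed the Gaussian with density `exp (-π * ‖x‖ ^ 2)` has entropy `m / 2`, while
encoding the integers nearest to `u n x / √2` costs at most `0.49 * ∑ n, ‖u n‖ ^ 2` nats on average.
By Gibbs' inequality the corresponding weights on rounding patterns integrate to at least
`exp (m / 100)`, although they sum to at most `1` over all patterns, so some translate of the
lattice has this many points with the same pattern, and their differences are the desired points.

Since polynomials grow more slowly than `φ ^ n`, finitely many `n` control all the others.
-/

open Finset Matrix Polynomial MeasureTheory ProbabilityTheory
open scoped ENNReal NNReal Real goldenRatio

section Laguerre

/-- The first order all-pass filter with pole `a`, acting on causal sequences: on generating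
functions it is multiplication by `(a - z) / (1 - a z)`. -/
def allPass {R : Type*} [CommRing R] (a : R) (x : ℕ → R) : ℕ → R
  | 0 => a * x 0
  | n + 1 => a * (allPass a x n + x (n + 1)) - x n

/-- The discrete Laguerre functions with pole `a`, without the factor `√(1 - a ^ 2)` that
normalizes them in `ℓ²`: the `j`-th one has generating function
`(a - z) ^ j / (1 - a z) ^ (j + 1)`. -/
def discreteLaguerre {R : Type*} [CommRing R] (a : R) : ℕ → ℕ → R
  | 0 => fun n ↦ a ^ n
  | j + 1 => allPass a (discreteLaguerre a j)

section CommRing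

variable {R : Type*} [CommRing R] (a : R)

theorem sum_allPass_sq (x : ℕ → R) (n : ℕ) :
    (1 - a ^ 2) * ∑ i ∈ range (n + 1), allPass a x i ^ 2 + (a * allPass a x n - x n) ^ 2 =
      (1 - a ^ 2) * ∑ i ∈ range (n + 1), x i ^ 2 := by
  induction n with
  | zero => simp only [zero_add, range_one, sum_singleton, allPass]; ring
  | succ n ih =>
    rw [sum_range_succ, sum_range_succ (fun i ↦ x i ^ 2), mul_add, mul_add, ← ih, allPass]
    ring

theorem discreteLaguerre_succ_succ (j n : ℕ) :
    discreteLaguerre a (j + 1) (n + 1) =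
      a * (discreteLaguerre a (j + 1) n + discreteLaguerre a j (n + 1)) -
        discreteLaguerre a j n :=
  rfl

theorem discreteLaguerre_zero_right (j : ℕ) : discreteLaguerre a j 0 = a ^ j := by
  induction j with
  | zero => rfl
  | succ j ih => rw [discreteLaguerre, allPass, ih, pow_succ']

theorem discreteLaguerre_comm (j n : ℕ) : discreteLaguerre a j n = discreteLaguerre a n j := by
  induction j generalizing n with
  | zero => rw [discreteLaguerre_zero_right, discreteLaguerre]
  | succ j ihj =>
    induction n with
    | zero => rw [discreteLaguerre_zero_right, discreteLaguerre]
    | succ n ihn =>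
      rw [discreteLaguerre_succ_succ, discreteLaguerre_succ_succ, ihn, ihj, ihj]
      ring

theorem sum_antidiagonal_choose_succ_mul_pow (f : ℕ → R) (k : ℕ) :
    ∑ ij ∈ antidiagonal (k + 1), ((k + 1).choose ij.1 : R) * (a ^ ij.2 * f ij.1) =
      ∑ ij ∈ antidiagonal k, (k.choose ij.1 : R) * (a ^ ij.2 * (a * f ij.1 + f (ij.1 + 1))) := by
  rw [sum_antidiagonal_choose_succ_mul fun i j ↦ a ^ j * f i, ← sum_add_distrib]
  refine sum_congr rfl fun ij hij ↦ ?_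
  rw [Nat.choose_symm_of_eq_add (mem_antidiagonal.1 hij).symm]
  ring

theorem sum_choose_mul_discreteLaguerre (n k : ℕ) :
    ∑ ij ∈ antidiagonal k,
        (k.choose ij.1 : R) * (a ^ ij.2 * ((-1) ^ ij.1 * discreteLaguerre a ij.1 n)) =
      n.choose k * (a ^ (n - k) * (1 - a ^ 2) ^ k) := by
  induction n generalizing k with
  | zero =>
    rcases k with _ | k
    · simp [discreteLaguerre]
    · rw [sum_antidiagonal_choose_succ_mul_pow a fun i ↦ (-1) ^ i * discreteLaguerre a i 0]
      simp only [discreteLaguerre_zero_right, Nat.choose_zero_succ, Nat.cast_zero, zero_mul]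
      exact sum_eq_zero fun _ _ ↦ by ring
  | succ n ih =>
    rcases k with _ | k
    · simp [discreteLaguerre]
    · have key : ∀ i, a * ((-1) ^ i * discreteLaguerre a i (n + 1)) +
          (-1) ^ (i + 1) * discreteLaguerre a (i + 1) (n + 1) =
          a * (a * ((-1) ^ i * discreteLaguerre a i n) +
            (-1) ^ (i + 1) * discreteLaguerre a (i + 1) n) +
          (1 - a ^ 2) * ((-1) ^ i * discreteLaguerre a i n) := fun i ↦ by
        rw [discreteLaguerre_succ_succ]; ring
      have ih' := ih (k + 1)
      rw [sum_antidiagonal_choose_succ_mul_pow a fun i ↦ (-1) ^ i * discreteLaguerre a i n] at ih'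
      rw [sum_antidiagonal_choose_succ_mul_pow a fun i ↦ (-1) ^ i * discreteLaguerre a i (n + 1)]
      simp only [key, mul_add, mul_left_comm _ a, mul_left_comm _ (1 - a ^ 2), sum_add_distrib,
        ← mul_sum] at ih' ⊢
      rw [← mul_add, ih', ih, Nat.choose_succ_succ', Nat.add_sub_add_right]
      rcases lt_or_ge k n with hk | hk
      · rw [show n - k = n - (k + 1) + 1 by lia]
        push_cast
        ring
      · rw [Nat.choose_eq_zero_of_lt (Nat.lt_succ_of_le hk)]
        push_cast
        ring

end CommRing

section OrderedRing

variable {R : Type*} [CommRing R] [LinearOrder R] [IsStrictOrderedRing R] (a : R)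

theorem sum_allPass_sq_le (x : ℕ → R) (N : ℕ) :
    (1 - a ^ 2) * ∑ i ∈ range N, allPass a x i ^ 2 ≤ (1 - a ^ 2) * ∑ i ∈ range N, x i ^ 2 := by
  rcases N with _ | n
  · simp
  · exact (le_add_of_nonneg_right (sq_nonneg _)).trans (sum_allPass_sq a x n).le

theorem sum_discreteLaguerre_sq_le (j N : ℕ) :
    (1 - a ^ 2) * ∑ n ∈ range N, discreteLaguerre a j n ^ 2 ≤ 1 := by
  induction j with
  | zero =>
    simp only [discreteLaguerre, pow_right_comm a _ 2]
    rw [mul_neg_geom_sum]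
    exact sub_le_self _ (pow_nonneg (sq_nonneg a) N)
  | succ j ih => exact (sum_allPass_sq_le a _ N).trans ih

end OrderedRing

end Laguerre

section PascalMatrix

/-- The lower unitriangular `m × m` Pascal matrix with parameter `c`, whose row `n` lists the
coefficients of `(X + c) ^ n`. -/
def pascalMatrix {R : Type*} [CommRing R] (c : R) (m : ℕ) : Matrix (Fin m) (Fin m) R :=
  Matrix.of fun n k ↦ ((n : ℕ).choose k : R) * c ^ ((n : ℕ) - k)

theorem det_pascalMatrix {R : Type*} [CommRing R] (c : R) (m : ℕ) : (pascalMatrix c m).det = 1 := by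
  rw [det_of_isLowerTriangular]
  · simp [pascalMatrix]
  · intro n k hnk
    have : (n : ℕ) < k := hnk
    simp [pascalMatrix, Nat.choose_eq_zero_of_lt this]

/-- The matrix whose columns are the first `m` normalized discrete Laguerre functions with pole
`a`, with alternating signs, truncated to their first `N` values. -/
noncomputable def laguerreMatrix (a : ℝ) (N m : ℕ) : Matrix (Fin N) (Fin m) ℝ :=
  Matrix.of fun n j ↦ √(1 - a ^ 2) * ((-1) ^ (j : ℕ) * discreteLaguerre a j n)

theorem laguerreMatrix_sq {a : ℝ} (ha : a ^ 2 ≤ 1) {N m : ℕ} (n : Fin N) (j : Fin m) :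
    laguerreMatrix a N m n j ^ 2 = (1 - a ^ 2) * discreteLaguerre a j n ^ 2 := by
  rw [laguerreMatrix, of_apply, mul_pow, mul_pow, Real.sq_sqrt (sub_nonneg.2 ha), pow_right_comm,
    neg_one_sq, one_pow, one_mul]

theorem sum_laguerreMatrix_col_sq_le {a : ℝ} (ha : a ^ 2 ≤ 1) (N : ℕ) {m : ℕ} (j : Fin m) :
    ∑ n, laguerreMatrix a N m n j ^ 2 ≤ 1 := by
  simp only [laguerreMatrix_sq ha, ← mul_sum]
  rw [Fin.sum_univ_eq_sum_range fun n ↦ discreteLaguerre a j n ^ 2]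
  exact sum_discreteLaguerre_sq_le a j N

theorem sum_laguerreMatrix_row_sq_le {a : ℝ} (ha : a ^ 2 ≤ 1) {N : ℕ} (m : ℕ) (n : Fin N) :
    ∑ j, laguerreMatrix a N m n j ^ 2 ≤ 1 := by
  simp only [laguerreMatrix_sq ha, ← mul_sum, discreteLaguerre_comm a _ n]
  rw [Fin.sum_univ_eq_sum_range fun j ↦ discreteLaguerre a n j ^ 2]
  exact sum_discreteLaguerre_sq_le a n m

theorem sum_laguerreMatrix_sq_le {a : ℝ} (ha : a ^ 2 ≤ 1) (N m : ℕ) :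
    ∑ n, ∑ j, laguerreMatrix a N m n j ^ 2 ≤ m := by
  rw [sum_comm]
  simpa using sum_le_sum fun j (_ : j ∈ univ) ↦ sum_laguerreMatrix_col_sq_le ha N (m := m) j

theorem sum_laguerreMatrix_row_sq_pos {a : ℝ} (ha₀ : a ≠ 0) (ha : a ^ 2 < 1) {N m : ℕ}
    [NeZero m] (n : Fin N) : 0 < ∑ j, laguerreMatrix a N m n j ^ 2 := by
  refine sum_pos' (fun j _ ↦ sq_nonneg _) ⟨0, mem_univ _, ?_⟩
  rw [laguerreMatrix_sq ha.le, Fin.val_zero, discreteLaguerre]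
  have := sub_pos.2 ha
  positivity

theorem laguerreMatrix_mul_transpose_pascalMatrix (a : ℝ) (N m : ℕ) :
    laguerreMatrix a N m * (pascalMatrix a m)ᵀ = Matrix.of fun (n : Fin N) (k : Fin m) ↦
      √(1 - a ^ 2) * ((n : ℕ).choose k * (a ^ ((n : ℕ) - k) * (1 - a ^ 2) ^ (k : ℕ))) := by
  ext n k
  rw [of_apply, ← sum_choose_mul_discreteLaguerre, mul_apply, mul_sum,
    Nat.sum_antidiagonal_eq_sum_range_succ_mk]
  simp only [laguerreMatrix, pascalMatrix, transpose_apply, of_apply]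
  rw [Fin.sum_univ_eq_sum_range (fun j ↦ √(1 - a ^ 2) * ((-1) ^ j * discreteLaguerre a j n) *
    (((k : ℕ).choose j : ℝ) * a ^ ((k : ℕ) - j))),
    ← sum_subset (range_subset_range.2 (Nat.succ_le_of_lt k.2))]
  · exact sum_congr rfl fun j _ ↦ by ring
  · intro j _ hj
    rw [Nat.choose_eq_zero_of_lt (by simpa using hj)]
    simp

end PascalMatrix

section Counting

theorem tsum_comp_le_mul_tsum {α β : Type*} {f : α → β} {M : ℝ≥0∞}
    (hM : ∀ b, ((f ⁻¹' {b}).encard : ℝ≥0∞) ≤ M) (g : β → ℝ≥0∞) :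
    ∑' a, g (f a) ≤ M * ∑' b, g b := by
  rw [← ENNReal.tsum_fiberwise _ f, ← ENNReal.tsum_mul_left]
  refine ENNReal.tsum_le_tsum fun b ↦ ?_
  rw [tsum_congr fun a : f ⁻¹' {b} ↦ congrArg g a.2, ENNReal.tsum_set_const]
  exact mul_le_mul_left (hM b) _

theorem tsum_prod_le_prod_tsum {ι β : Type*} [Fintype ι] (q : ι → β → ℝ≥0∞) :
    ∑' k : ι → β, ∏ n, q n (k n) ≤ ∏ n, ∑' b, q n b := by
  classical
  rw [ENNReal.tsum_eq_iSup_sum]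
  refine iSup_le fun F ↦ ?_
  calc ∑ k ∈ F, ∏ n, q n (k n)
      ≤ ∑ k ∈ Fintype.piFinset fun n ↦ F.image fun k ↦ k n, ∏ n, q n (k n) :=
        sum_le_sum_of_subset fun k hk ↦
          Fintype.mem_piFinset.2 fun n ↦ mem_image_of_mem (fun k ↦ k n) hk
    _ = ∏ n, ∑ b ∈ F.image fun k ↦ k n, q n b := (prod_univ_sum _ _).symm
    _ ≤ ∏ n, ∑' b, q n b := prod_le_prod' fun n _ ↦ ENNReal.sum_le_tsum _

theorem abs_sub_le_one_of_round_eq {x y : ℝ} (h : round x = round y) : |x - y| ≤ 1 := by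
  have hx := abs_sub_round x
  have hy := abs_sub_round y
  rw [← h, abs_sub_comm] at hy
  linarith [abs_sub_le x (round x) y]

theorem encard_round_eq_le {ι A : Type*} [AddCommGroup A] (L : A →+ ι → ℝ) (c : ι → ℝ)
    (k : ι → ℤ) :
    {a | (fun n ↦ round (c n + L a n)) = k}.encard ≤ {a | ∀ n, |L a n| ≤ 1}.encard := by
  rcases Set.eq_empty_or_nonempty {a | (fun n ↦ round (c n + L a n)) = k} with h | ⟨b, hb⟩
  · simp [h]
  · refine Set.encard_le_encard_of_injOn (f := (· - b)) (fun a ha n ↦ ?_)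
      sub_left_injective.injOn
    have hab : round (c n + L a n) = round (c n + L b n) := congrFun (ha.trans hb.symm) n
    simpa using abs_sub_le_one_of_round_eq hab

theorem tsum_prod_round_le_encard {ι A : Type*} [Fintype ι] [AddCommGroup A] (L : A →+ ι → ℝ)
    (c : ι → ℝ) {q : ι → ℤ → ℝ≥0∞} (hq : ∀ n, ∑' k, q n k ≤ 1) :
    ∑' a, ∏ n, q n (round (c n + L a n)) ≤ ({a | ∀ n, |L a n| ≤ 1}.encard : ℝ≥0∞) := by
  refine (tsum_comp_le_mul_tsum (f := fun a n ↦ round (c n + L a n))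
    (fun k ↦ ENat.toENNReal_mono (encard_round_eq_le L c k)) fun k ↦ ∏ n, q n (k n)).trans ?_
  exact mul_le_of_le_one_right' ((tsum_prod_le_prod_tsum q).trans (prod_le_one' fun n _ ↦ hq n))

theorem measurable_round : Measurable (round : ℝ → ℤ) := by
  simp only [funext (round_eq (α := ℝ))]
  fun_prop

variable {κ : Type*} [Fintype κ] [DecidableEq κ]

theorem lintegral_le_of_tsum_zspan_le (b : Module.Basis κ ℝ (κ → ℝ)) {f : (κ → ℝ) → ℝ≥0∞}
    (hf : Measurable f) {M : ℝ≥0∞} (h : ∀ s, ∑' a : κ → ℤ, f (s + ∑ k, a k • b k) ≤ M) :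
    ∫⁻ x, f x ≤ M * ENNReal.ofReal |(Matrix.of b).det| := by
  have hF := ZSpan.isAddFundamentalDomain b (volume : Measure (κ → ℝ))
  have : VAddInvariantMeasure (Submodule.span ℤ (Set.range b)) (κ → ℝ) volume :=
    inferInstanceAs <| VAddInvariantMeasure (Submodule.span ℤ (Set.range b)).toAddSubgroup _ _
  have : Countable (Submodule.span ℤ (Set.range b)) :=
    (b.restrictScalars ℤ).equivFun.toEquiv.injective.countable
  rw [hF.lintegral_eq_tsum'',
    ← lintegral_tsum (f := fun (g : Submodule.span ℤ (Set.range b)) x ↦ f (g +ᵥ x))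
      fun g ↦ (hf.comp (measurable_const_vadd g)).aemeasurable,
    ← ZSpan.volume_fundamentalDomain, ← setLIntegral_const]
  refine lintegral_mono fun x ↦ le_of_eq_of_le ?_ (h x)
  rw [← (b.restrictScalars ℤ).equivFun.symm.toEquiv.tsum_eq]
  refine tsum_congr fun a ↦ congrArg f ?_
  simp only [LinearEquiv.coe_toEquiv, Module.Basis.equivFun_symm_apply, Submodule.vadd_def,
    vadd_eq_add, Submodule.coe_sum, Submodule.coe_smul, Module.Basis.restrictScalars_apply]
  exact add_comm _ _

theorem lintegral_le_of_tsum_mulVec_le {B : Matrix κ κ ℝ} (hB : B.det ≠ 0)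
    {f : (κ → ℝ) → ℝ≥0∞} (hf : Measurable f) {M : ℝ≥0∞}
    (h : ∀ s, ∑' a : κ → ℤ, f (s + B *ᵥ fun k ↦ (a k : ℝ)) ≤ M) :
    ∫⁻ x, f x ≤ M * ENNReal.ofReal |B.det| := by
  have hli := linearIndependent_cols_of_det_ne_zero hB
  let b := Module.Basis.mk hli (hli.span_eq_top_of_card_eq_finrank' (by simp)).ge
  have hb : ⇑b = Bᵀ := Module.Basis.coe_mk _ _
  refine (lintegral_le_of_tsum_zspan_le b hf (M := M) fun s ↦ ?_).trans_eq ?_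
  · simpa only [hb, mulVec_eq_sum, op_smul_eq_smul, Int.cast_smul_eq_zsmul] using h s
  · rw [hb, ← det_transpose B]
    rfl

theorem lintegral_prod_round_le {ι : Type*} [Fintype ι] (U : Matrix ι κ ℝ) {B : Matrix κ κ ℝ}
    (hB : B.det ≠ 0) {q : ι → ℤ → ℝ≥0∞} (hq : ∀ n, ∑' k, q n k ≤ 1) :
    ∫⁻ x, ∏ n, q n (round ((U *ᵥ x) n)) ≤
      ({a : κ → ℤ | ∀ n, |((U * B) *ᵥ fun k ↦ (a k : ℝ)) n| ≤ 1}.encard : ℝ≥0∞) *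
        ENNReal.ofReal |B.det| := by
  refine lintegral_le_of_tsum_mulVec_le hB ?_ fun s ↦ ?_
  · exact measurable_fun_prod _ fun n _ ↦
      measurable_from_top.comp (measurable_round.comp (by fun_prop))
  · let L : (κ → ℤ) →+ ι → ℝ :=
      (U * B).mulVecLin.toAddMonoidHom.comp ((Int.castAddHom ℝ).compLeft κ)
    refine le_of_eq_of_le ?_ (tsum_prod_round_le_encard L (U *ᵥ s) hq)
    simp only [mulVec_add, mulVec_mulVec, Pi.add_apply]
    rfl

end Counting

section Gibbs

variable {α : Type*} [MeasurableSpace α] {μ ν : Measure α} [IsProbabilityMeasure μ]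

theorem ofReal_exp_integral_le_lintegral_exp {Z : α → ℝ} (hZ : Integrable Z μ) :
    ENNReal.ofReal (Real.exp (∫ x, Z x ∂μ)) ≤ ∫⁻ x, ENNReal.ofReal (Real.exp (Z x)) ∂μ := by
  have hexp_nonneg : 0 ≤ᵐ[μ] fun x ↦ Real.exp (Z x) := ae_of_all _ fun x ↦ (Real.exp_pos _).le
  by_cases hexp : Integrable (fun x ↦ Real.exp (Z x)) μ
  · rw [← ofReal_integral_eq_lintegral_ofReal hexp hexp_nonneg]
    exact ENNReal.ofReal_le_ofReal <| convexOn_exp.map_integral_le Real.continuous_exp.continuousOn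
      isClosed_univ (ae_of_all _ fun _ ↦ trivial) hZ hexp
  · refine le_top.trans_eq (Eq.symm ?_)
    rwa [← lintegral_ofReal_ne_top_iff_integrable
      (Real.continuous_exp.comp_aestronglyMeasurable hZ.1) hexp_nonneg, not_ne_iff] at hexp

theorem ofReal_exp_sub_le_lintegral_exp_neg {H G : α → ℝ}
    (hμ : μ = ν.withDensity fun x ↦ ENNReal.ofReal (Real.exp (-H x))) (hHm : Measurable H)
    (hH : Integrable H μ) (hG : Integrable G μ) :
    ENNReal.ofReal (Real.exp (∫ x, H x ∂μ - ∫ x, G x ∂μ)) ≤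
      ∫⁻ x, ENNReal.ofReal (Real.exp (-G x)) ∂ν := by
  rw [← integral_sub hH hG]
  refine (ofReal_exp_integral_le_lintegral_exp (hH.sub hG)).trans ?_
  rw [hμ]
  refine (lintegral_withDensity_le_lintegral_mul ν (by fun_prop) _).trans_eq ?_
  refine lintegral_congr fun x ↦ ?_
  rw [Pi.mul_apply, ← ENNReal.ofReal_mul (Real.exp_pos _).le, ← Real.exp_add]
  congr 2
  rw [Pi.sub_apply]
  ring

end Gibbs

section Gaussian

theorem pi_withDensity_ofReal {ι : Type*} [Fintype ι] {E : ι → Type*}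
    [∀ i, MeasurableSpace (E i)] (μ : ∀ i, Measure (E i)) [∀ i, SigmaFinite (μ i)]
    {f : ∀ i, E i → ℝ} (hf : ∀ i, Integrable (f i) (μ i)) (hf₀ : ∀ i, 0 ≤ f i) :
    Measure.pi (fun i ↦ (μ i).withDensity fun x ↦ ENNReal.ofReal (f i x)) =
      (Measure.pi μ).withDensity fun x ↦ ENNReal.ofReal (∏ i, f i (x i)) := by
  have : ∀ i, SigmaFinite ((μ i).withDensity fun x ↦ ENNReal.ofReal (f i x)) := fun i ↦
    SigmaFinite.withDensity_ofReal (f i)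
  refine Measure.pi_eq fun s hs ↦ ?_
  have hind : ∀ x, (Set.univ.pi s).indicator (fun x ↦ ENNReal.ofReal (∏ i, f i (x i))) x =
      ENNReal.ofReal (∏ i, (s i).indicator (f i) (x i)) := fun x ↦ by
    by_cases hx : x ∈ Set.univ.pi s
    · rw [Set.indicator_of_mem hx]
      simp only [fun i ↦ Set.indicator_of_mem (hx i trivial) (f i)]
    · obtain ⟨i, hi⟩ : ∃ i, x i ∉ s i := by simpa using hx
      rw [Set.indicator_of_notMem hx,
        prod_eq_zero (mem_univ i) (Set.indicator_of_notMem hi _), ENNReal.ofReal_zero]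
  have hind₀ : ∀ i x, 0 ≤ (s i).indicator (f i) x := fun i ↦ Set.indicator_nonneg fun x _ ↦ hf₀ i x
  have hs' := MeasurableSet.univ_pi hs
  rw [withDensity_apply _ hs', ← lintegral_indicator hs', lintegral_congr hind,
    ← ofReal_integral_eq_lintegral_ofReal, integral_fintype_prod_eq_prod,
    ENNReal.ofReal_prod_of_nonneg fun i _ ↦ integral_nonneg (hind₀ i)]
  · refine prod_congr rfl fun i _ ↦ ?_
    rw [withDensity_apply _ (hs i), integral_indicator (hs i),
      ofReal_integral_eq_lintegral_ofReal (hf i).restrict (ae_of_all _ (hf₀ i))]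
  · exact Integrable.fintype_prod_dep fun i ↦ (hf i).indicator (hs i)
  · exact ae_of_all _ fun x ↦ prod_nonneg fun i _ ↦ hind₀ i (x i)

/-- The Gaussian probability measure on `ℝ^κ` with density `exp (-π * ∑ j, x j ^ 2)`, a density
which is its own Fourier transform. Its coordinates are independent of variance `1 / (2 * π)`. -/
noncomputable def selfDualGaussian (κ : Type*) [Fintype κ] : Measure (κ → ℝ) :=
  Measure.pi fun _ ↦ gaussianReal 0 (2 * NNReal.pi)⁻¹

variable {κ : Type*} [Fintype κ]

instance : IsProbabilityMeasure (selfDualGaussian κ) :=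
  inferInstanceAs (IsProbabilityMeasure (Measure.pi _))

theorem selfDualGaussian_eq_withDensity :
    selfDualGaussian κ = volume.withDensity
      fun x ↦ ENNReal.ofReal (Real.exp (-(π * ∑ j, x j ^ 2))) := by
  have hv : (2 * NNReal.pi)⁻¹ ≠ 0 := by simp [NNReal.pi_ne_zero]
  have hpdf (y : ℝ) : gaussianPDFReal 0 (2 * NNReal.pi)⁻¹ y = Real.exp (-(π * y ^ 2)) := by
    have hsqrt : √(2 * π * (2 * π)⁻¹) = 1 := by
      rw [mul_inv_cancel₀ (by positivity), Real.sqrt_one]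
    simp only [gaussianPDFReal, NNReal.coe_inv, NNReal.coe_mul, NNReal.coe_ofNat,
      NNReal.coe_real_pi, hsqrt, inv_one, one_mul, sub_zero]
    congr 1
    field_simp
  simp only [mul_sum, ← sum_neg_distrib, Real.exp_sum, ← hpdf, selfDualGaussian,
    gaussianReal_of_var_ne_zero _ hv]
  exact pi_withDensity_ofReal _ (fun _ ↦ integrable_gaussianPDFReal _ _)
    fun _ ↦ gaussianPDFReal_nonneg _ _

theorem integral_sq_gaussianReal (v : ℝ≥0) : ∫ x, x ^ 2 ∂gaussianReal 0 v = v := by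
  rw [← variance_fun_id_gaussianReal (μ := 0) (v := v), variance_of_integral_eq_zero
    (by fun_prop) integral_id_gaussianReal]

theorem integrable_sq_gaussianReal (v : ℝ≥0) : Integrable (fun x ↦ x ^ 2) (gaussianReal 0 v) :=
  (memLp_id_gaussianReal' 2 (by simp)).integrable_sq

theorem integrable_sq_eval_selfDualGaussian (j : κ) :
    Integrable (fun x ↦ x j ^ 2) (selfDualGaussian κ) :=
  integrable_comp_eval (μ := fun _ : κ ↦ gaussianReal 0 _) (integrable_sq_gaussianReal _)

theorem integral_sq_eval_selfDualGaussian (j : κ) :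
    ∫ x, x j ^ 2 ∂selfDualGaussian κ = (2 * π)⁻¹ := by
  refine (integral_comp_eval (μ := fun _ : κ ↦ gaussianReal 0 (2 * NNReal.pi)⁻¹)
    (f := fun x : ℝ ↦ x ^ 2) (by fun_prop)).trans ?_
  simp [integral_sq_gaussianReal]

theorem integrable_pi_mul_sum_sq_selfDualGaussian :
    Integrable (fun x ↦ π * ∑ j, x j ^ 2) (selfDualGaussian κ) :=
  (integrable_finsetSum _ fun j _ ↦ integrable_sq_eval_selfDualGaussian j).const_mul _

theorem integral_pi_mul_sum_sq_selfDualGaussian :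
    ∫ x, π * ∑ j, x j ^ 2 ∂selfDualGaussian κ = Fintype.card κ / 2 := by
  rw [integral_const_mul, integral_finsetSum _ fun j _ ↦ integrable_sq_eval_selfDualGaussian j]
  simp only [integral_sq_eval_selfDualGaussian, sum_const, card_univ, nsmul_eq_mul]
  field_simp

theorem map_dotProduct_selfDualGaussian (c : κ → ℝ) :
    (selfDualGaussian κ).map (c ⬝ᵥ ·) = gaussianReal 0 ((∑ j, c j ^ 2) / (2 * π)).toNNReal := by
  have hL2 (j : κ) : MemLp (fun x ↦ c j * x) 2 (gaussianReal 0 (2 * NNReal.pi)⁻¹) :=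
    (memLp_id_gaussianReal' 2 (by simp)).const_mul (c j)
  have hlaw (j : κ) : HasGaussianLaw (fun x ↦ c j * x j) (selfDualGaussian κ) :=
    (measurePreserving_eval _ j).hasLaw.hasGaussianLaw.fun_smul (c j)
  have hsum : HasGaussianLaw (c ⬝ᵥ ·) (selfDualGaussian κ) :=
    (iIndepFun_pi fun j ↦ (hL2 j).aestronglyMeasurable.aemeasurable).hasGaussianLaw_fun_sum hlaw
  rw [hsum.map_eq_gaussianReal]
  congr 2
  · simp only [dotProduct]
    rw [integral_finsetSum _ fun j _ ↦ (hlaw j).integrable]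
    refine sum_eq_zero fun j _ ↦ ?_
    rw [integral_const_mul, selfDualGaussian, integral_eval, integral_id_gaussianReal, mul_zero]
  · have : (c ⬝ᵥ ·) = ∑ j, fun x : κ → ℝ ↦ c j * x j := by ext x; simp [dotProduct]
    rw [this, selfDualGaussian, variance_sum_pi hL2]
    have hvar (j : κ) := variance_const_mul (c j) (fun x ↦ x) (gaussianReal 0 (2 * NNReal.pi)⁻¹)
    simp only [hvar, variance_fun_id_gaussianReal, ← sum_mul]
    simp [div_eq_mul_inv]

end Gaussian

section RoundingCost

theorem hasSum_pow_natAbs {K : Type*} [NormedDivisionRing K] {r : K} (hr : ‖r‖ < 1) :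
    HasSum (fun k : ℤ ↦ r ^ k.natAbs) ((1 + r) * (1 - r)⁻¹) := by
  have hgeom := hasSum_geometric_of_norm_lt_one hr
  rw [add_mul, one_mul]
  refine HasSum.of_nat_of_neg_add_one (by simpa using hgeom)
    ((hgeom.mul_left r).congr_fun fun n ↦ ?_)
  rw [show (-((n : ℤ) + 1)).natAbs = n + 1 by lia, pow_succ']

/-- The ideal code length of the integer `k`, in nats, under the two-sided geometric distribution
of ratio `r`, which gives `k` the probability `(1 - r) / (1 + r) * r ^ |k|`. -/
noncomputable def geomCost (r : ℝ) (k : ℤ) : ℝ :=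
  Real.log ((1 + r) / (1 - r)) - Real.log r * |(k : ℝ)|

theorem exp_neg_geomCost {r : ℝ} (hr₀ : 0 < r) (hr₁ : r < 1) (k : ℤ) :
    Real.exp (-geomCost r k) = (1 - r) / (1 + r) * r ^ k.natAbs := by
  have := sub_pos.2 hr₁
  rw [geomCost, neg_sub, sub_eq_neg_add, Real.exp_add, Real.exp_neg, Real.exp_log (by positivity),
    inv_div, Real.exp_mul, Real.exp_log hr₀, ← Int.cast_abs, ← Int.natCast_natAbs,
    Int.cast_natCast, Real.rpow_natCast]

theorem tsum_exp_neg_geomCost {r : ℝ} (hr₀ : 0 < r) (hr₁ : r < 1) :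
    ∑' k, ENNReal.ofReal (Real.exp (-geomCost r k)) = 1 := by
  have hsum : HasSum (fun k ↦ Real.exp (-geomCost r k)) 1 := by
    have := sub_pos.2 hr₁
    simp only [exp_neg_geomCost hr₀ hr₁]
    convert! (hasSum_pow_natAbs (by rwa [Real.norm_of_nonneg hr₀.le])).mul_left ((1 - r) / (1 + r))
      using 1
    field_simp
  rw [← ENNReal.ofReal_tsum_of_nonneg (fun k ↦ (Real.exp_pos _).le) hsum.summable, hsum.tsum_eq,
    ENNReal.ofReal_one]

theorem abs_round_le (y : ℝ) : |(round y : ℝ)| ≤ 2 * |y| := by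
  have h₀ := round_le y 0
  have h₁ := abs_sub_abs_le_abs_sub (round y : ℝ) y
  rw [Int.cast_zero, sub_zero, abs_sub_comm] at h₀
  linarith

theorem integrable_abs_gaussianReal (w : ℝ≥0) : Integrable (fun y ↦ |y|) (gaussianReal 0 w) :=
  ((memLp_id_gaussianReal' 1 (by simp)).integrable le_rfl).abs

theorem integrable_abs_round_gaussianReal (w : ℝ≥0) :
    Integrable (fun y ↦ |(round y : ℝ)|) (gaussianReal 0 w) := by
  have hmeas : Measurable fun y ↦ |(round y : ℝ)| :=
    (measurable_from_top (f := fun k : ℤ ↦ |(k : ℝ)|)).comp measurable_round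
  refine ((integrable_abs_gaussianReal w).const_mul 2).mono' hmeas.aestronglyMeasurable ?_
  exact ae_of_all _ fun y ↦ by simpa using abs_round_le y

theorem integral_Ioi_mul_gaussianPDFReal {w : ℝ≥0} (hw : w ≠ 0) {a : ℝ} (ha : 0 ≤ a) :
    ∫ x in Set.Ioi a, x * gaussianPDFReal 0 w x = w * gaussianPDFReal 0 w a := by
  have hderiv (x : ℝ) : HasDerivAt (fun x ↦ -w * gaussianPDFReal 0 w x)
      (x * gaussianPDFReal 0 w x) x := by
    simp only [gaussianPDFReal_def, sub_zero]
    have hexponent : HasDerivAt (fun x : ℝ ↦ -x ^ 2 / (2 * w)) (-(2 * x) / (2 * w)) x := by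
      simpa using (hasDerivAt_pow 2 x).neg.div_const (2 * (w : ℝ))
    convert! (hexponent.exp.const_mul (√(2 * π * w))⁻¹).const_mul (-w : ℝ) using 1
    field_simp
  have hlim : Filter.Tendsto (fun x ↦ -w * gaussianPDFReal 0 w x) Filter.atTop (nhds 0) := by
    have hexponent : Filter.Tendsto (fun x : ℝ ↦ -x ^ 2 / (2 * w)) Filter.atTop Filter.atBot :=
      (Filter.tendsto_neg_atTop_atBot.comp (Filter.tendsto_pow_atTop two_ne_zero)).atBot_div_const
        (by positivity)
    simpa [gaussianPDFReal_def] using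
      ((Real.tendsto_exp_atBot.comp hexponent).const_mul (√(2 * π * w))⁻¹).const_mul (-w : ℝ)
  rw [integral_Ioi_of_hasDerivAt_of_nonneg' (fun x _ ↦ hderiv x) (fun x hx ↦ ?_) hlim]
  · ring
  · exact mul_nonneg (ha.trans hx.out.le) (gaussianPDFReal_nonneg 0 w x)

theorem setIntegral_abs_gaussianReal {w : ℝ≥0} (hw : w ≠ 0) {a : ℝ} (ha : 0 < a) :
    ∫ y in {y | a ≤ |y|}, |y| ∂gaussianReal 0 w = 2 * w * gaussianPDFReal 0 w a := by
  have hmeas : MeasurableSet {y : ℝ | a ≤ |y|} := measurableSet_le (by fun_prop) (by fun_prop)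
  have hpdf (y : ℝ) : gaussianPDFReal 0 w |y| = gaussianPDFReal 0 w y := by simp [gaussianPDFReal]
  have heven (y : ℝ) : gaussianPDFReal 0 w y • {y | a ≤ |y|}.indicator (fun y ↦ |y|) y =
      (Set.Ici a).indicator (fun x ↦ x * gaussianPDFReal 0 w x) |y| := by
    simp only [Set.indicator_apply, Set.mem_ofPred_eq, Set.mem_Ici, hpdf, smul_eq_mul]
    split_ifs <;> ring
  rw [← integral_indicator hmeas, integral_gaussianReal_eq_integral_smul hw]
  simp only [heven]
  rw [integral_comp_abs, setIntegral_indicator measurableSet_Ici,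
    Set.inter_eq_right.2 (Set.Ici_subset_Ioi.2 ha), integral_Ici_eq_integral_Ioi,
    integral_Ioi_mul_gaussianPDFReal hw ha.le, mul_assoc]

theorem integral_abs_round_gaussianReal_le {w : ℝ≥0} (hw : w ≠ 0) :
    ∫ y, |(round y : ℝ)| ∂gaussianReal 0 w ≤ 4 * w * gaussianPDFReal 0 w (1 / 2) := by
  have hzero (y : ℝ) (hy : y ∉ {y : ℝ | 1 / 2 ≤ |y|}) : |(round y : ℝ)| = 0 := by
    rw [Set.mem_ofPred_eq, not_le, abs_lt] at hy
    rw [round_eq_zero_iff.2 ⟨hy.1.le, hy.2⟩, Int.cast_zero, abs_zero]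
  calc ∫ y, |(round y : ℝ)| ∂gaussianReal 0 w
      = ∫ y in {y | 1 / 2 ≤ |y|}, |(round y : ℝ)| ∂gaussianReal 0 w :=
        (setIntegral_eq_integral_of_forall_compl_eq_zero hzero).symm
    _ ≤ ∫ y in {y | 1 / 2 ≤ |y|}, 2 * |y| ∂gaussianReal 0 w :=
        integral_mono (integrable_abs_round_gaussianReal w).integrableOn
          ((integrable_abs_gaussianReal w).const_mul 2).integrableOn abs_round_le
    _ = 4 * w * gaussianPDFReal 0 w (1 / 2) := by
        rw [integral_const_mul, setIntegral_abs_gaussianReal hw one_half_pos]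
        ring

theorem exp_neg_pi_div_le {u : ℝ} (hu : 0 < u) : Real.exp (-(π / u)) ≤ u ^ 3 / 16 := by
  have hexp : Real.exp (-(1 / u)) ≤ u / Real.exp 1 := by
    have h := Real.add_one_le_exp (1 / u - 1)
    rw [sub_add_cancel, Real.exp_sub, le_div_iff₀ (Real.exp_pos 1), one_div_mul_eq_div] at h
    rwa [Real.exp_neg, inv_le_comm₀ (Real.exp_pos _) (by positivity), inv_div]
  have he : 16 ≤ Real.exp 1 ^ 3 := by
    have := pow_le_pow_left₀ (by norm_num) Real.exp_one_gt_d9.le 3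
    norm_num at this ⊢
    linarith
  calc Real.exp (-(π / u)) ≤ Real.exp (3 * -(1 / u)) := by
        rw [Real.exp_le_exp, mul_neg, mul_one_div, neg_le_neg_iff]
        gcongr
        exact Real.pi_gt_three.le
    _ = Real.exp (-(1 / u)) ^ 3 := Real.exp_nat_mul _ 3
    _ ≤ (u / Real.exp 1) ^ 3 := by gcongr
    _ ≤ u ^ 3 / 16 := by
        rw [div_pow]
        gcongr

theorem four_mul_gaussianPDFReal_one_half_le {u : ℝ} (hu : 0 < u) :
    4 * (u / (4 * π)).toNNReal * gaussianPDFReal 0 (u / (4 * π)).toNNReal (1 / 2) ≤ u ^ 2 / 8 := by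
  have hw : ((u / (4 * π)).toNNReal : ℝ) = u / (4 * π) := Real.coe_toNNReal _ (by positivity)
  have hexponent : 2 * (-(1 / 2 - 0) ^ 2 / (2 * (u / (4 * π)))) = -(π / u) := by
    field_simp
    norm_num
  have hpi : 9 ≤ π ^ 2 := by nlinarith [Real.pi_gt_three]
  refine le_of_sq_le_sq ?_ (by positivity)
  calc (4 * (u / (4 * π)).toNNReal * gaussianPDFReal 0 (u / (4 * π)).toNNReal (1 / 2)) ^ 2
      = 2 * u / π ^ 2 * Real.exp (-(π / u)) := by
        rw [gaussianPDFReal, hw, mul_pow, mul_pow, mul_pow, inv_pow, Real.sq_sqrt (by positivity),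
          ← Real.exp_nat_mul, Nat.cast_ofNat, hexponent]
        field_simp
        norm_num
    _ ≤ 2 * u / 9 * (u ^ 3 / 16) := by
        gcongr
        exact exp_neg_pi_div_le hu
    _ ≤ (u ^ 2 / 8) ^ 2 := by
        have := pow_pos hu 4
        linarith

theorem neg_log_div_le {u : ℝ} (hu₀ : 0 < u) (hu₁ : u ≤ 1) : -Real.log (u / 16) ≤ 2.8 / u := by
  have hlog16 : Real.log 16 = 4 * Real.log 2 := by
    rw [show (16 : ℝ) = 2 ^ 4 by norm_num, Real.log_pow, Nat.cast_ofNat]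
  have hlog := Real.log_le_sub_one_of_pos (inv_pos.2 hu₀)
  have hinv := (one_le_inv₀ hu₀).2 hu₁
  have hlog2 := Real.log_two_lt_d9
  rw [Real.log_inv] at hlog
  rw [Real.log_div hu₀.ne' (by norm_num), hlog16, div_eq_mul_inv]
  linarith

theorem log_one_add_div_one_sub_le {r : ℝ} (hr₀ : -1 < r) (hr₁ : r < 1) :
    Real.log ((1 + r) / (1 - r)) ≤ 2 * r / (1 - r) := by
  have hsub := sub_pos.2 hr₁
  refine (Real.log_le_sub_one_of_pos (div_pos (by linarith) hsub)).trans_eq ?_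
  field_simp
  ring

theorem integrable_geomCost_round_gaussianReal (r : ℝ) (w : ℝ≥0) :
    Integrable (fun y ↦ geomCost r (round y)) (gaussianReal 0 w) :=
  (integrable_const _).sub ((integrable_abs_round_gaussianReal w).const_mul _)

-- What matters is that `0.49` is below `1 / 2`, the entropy per variable of `selfDualGaussian`.
-- The ratio `u / 16` is a convenient choice achieving this uniformly in `u`.
theorem integral_geomCost_round_gaussianReal_le {u : ℝ} (hu₀ : 0 < u) (hu₁ : u ≤ 1) :
    ∫ y, geomCost (u / 16) (round y) ∂gaussianReal 0 (u / (4 * π)).toNNReal ≤ 0.49 * u := by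
  have hround : ∫ y, |(round y : ℝ)| ∂gaussianReal 0 (u / (4 * π)).toNNReal ≤ u ^ 2 / 8 :=
    (integral_abs_round_gaussianReal_le (Real.toNNReal_pos.2 (by positivity)).ne').trans
      (four_mul_gaussianPDFReal_one_half_le hu₀)
  have hlog : Real.log ((1 + u / 16) / (1 - u / 16)) ≤ 0.14 * u :=
    (log_one_add_div_one_sub_le (by linarith) (by linarith)).trans <| by
      rw [div_le_iff₀ (by linarith)]
      nlinarith
  calc ∫ y, geomCost (u / 16) (round y) ∂gaussianReal 0 (u / (4 * π)).toNNReal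
      = Real.log ((1 + u / 16) / (1 - u / 16)) + -Real.log (u / 16) *
          ∫ y, |(round y : ℝ)| ∂gaussianReal 0 (u / (4 * π)).toNNReal := by
        simp only [geomCost]
        rw [integral_sub (integrable_const _)
          ((integrable_abs_round_gaussianReal _).const_mul _), integral_const_mul]
        simp [sub_eq_add_neg]
    _ ≤ 0.14 * u + 2.8 / u * (u ^ 2 / 8) := by
        gcongr
        exact neg_log_div_le hu₀ hu₁
    _ = 0.49 * u := by
        field_simp
        ring

end RoundingCost

section LinearForms

variable {ι κ : Type*} [Fintype ι] [Fintype κ]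

theorem measurePreserving_dotProduct_selfDualGaussian (c : κ → ℝ) :
    MeasurePreserving ((√2)⁻¹ • c ⬝ᵥ ·) (selfDualGaussian κ)
      (gaussianReal 0 ((∑ j, c j ^ 2) / (4 * π)).toNNReal) := by
  refine ⟨by fun_prop, ?_⟩
  rw [map_dotProduct_selfDualGaussian]
  simp only [Pi.smul_apply, smul_eq_mul, mul_pow, inv_pow, Real.sq_sqrt zero_le_two, ← mul_sum]
  congr 2
  ring

theorem integrable_geomCost_round_dotProduct (r : ℝ) (c : κ → ℝ) :
    Integrable (fun x ↦ geomCost r (round ((√2)⁻¹ • c ⬝ᵥ x))) (selfDualGaussian κ) :=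
  (measurePreserving_dotProduct_selfDualGaussian c).integrable_comp_of_integrable
    (integrable_geomCost_round_gaussianReal r _)

theorem integral_geomCost_round_dotProduct_le {c : κ → ℝ} (hpos : 0 < ∑ j, c j ^ 2)
    (hle : ∑ j, c j ^ 2 ≤ 1) :
    ∫ x, geomCost ((∑ j, c j ^ 2) / 16) (round ((√2)⁻¹ • c ⬝ᵥ x)) ∂selfDualGaussian κ ≤
      0.49 * ∑ j, c j ^ 2 := by
  have hmp := measurePreserving_dotProduct_selfDualGaussian c
  refine le_of_eq_of_le ?_ (integral_geomCost_round_gaussianReal_le hpos hle)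
  rw [← hmp.map_eq, integral_map hmp.aemeasurable]
  rw [hmp.map_eq]
  exact (integrable_geomCost_round_gaussianReal _ _).aestronglyMeasurable

theorem ofReal_exp_le_lintegral_prod_exp_neg_geomCost {U : Matrix ι κ ℝ}
    (hpos : ∀ n, 0 < ∑ j, U n j ^ 2) (hrow : ∀ n, ∑ j, U n j ^ 2 ≤ 1)
    (hsum : ∑ n, ∑ j, U n j ^ 2 ≤ Fintype.card κ) :
    ENNReal.ofReal (Real.exp (Fintype.card κ / 100)) ≤ ∫⁻ x : κ → ℝ, ∏ n, ENNReal.ofReal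
      (Real.exp (-geomCost ((∑ j, U n j ^ 2) / 16) (round ((((√2)⁻¹ • U) *ᵥ x) n)))) := by
  let G (x : κ → ℝ) : ℝ :=
    ∑ n, geomCost ((∑ j, U n j ^ 2) / 16) (round ((((√2)⁻¹ • U) *ᵥ x) n))
  have hint (n : ι) := integrable_geomCost_round_dotProduct ((∑ j, U n j ^ 2) / 16) (U n)
  have hG : ∫ x, G x ∂selfDualGaussian κ ≤ 0.49 * Fintype.card κ :=
    calc ∫ x, G x ∂selfDualGaussian κ
        = ∑ n, ∫ x, geomCost ((∑ j, U n j ^ 2) / 16) (round ((√2)⁻¹ • U n ⬝ᵥ x))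
            ∂selfDualGaussian κ := integral_finsetSum _ fun n _ ↦ hint n
      _ ≤ ∑ n, 0.49 * ∑ j, U n j ^ 2 := sum_le_sum fun n _ ↦
          integral_geomCost_round_dotProduct_le (hpos n) (hrow n)
      _ ≤ 0.49 * Fintype.card κ := by
          rw [← mul_sum]
          gcongr
  have hgibbs := ofReal_exp_sub_le_lintegral_exp_neg selfDualGaussian_eq_withDensity
    (by fun_prop) integrable_pi_mul_sum_sq_selfDualGaussian
    (integrable_finsetSum univ fun n _ ↦ hint n : Integrable G (selfDualGaussian κ))
  rw [integral_pi_mul_sum_sq_selfDualGaussian] at hgibbs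
  calc ENNReal.ofReal (Real.exp (Fintype.card κ / 100))
      ≤ ENNReal.ofReal (Real.exp (Fintype.card κ / 2 - ∫ x, G x ∂selfDualGaussian κ)) := by
        gcongr
        linarith
    _ ≤ ∫⁻ x, ENNReal.ofReal (Real.exp (-G x)) := hgibbs
    _ = _ := lintegral_congr fun x ↦ by
        rw [← sum_neg_distrib, Real.exp_sum,
          ENNReal.ofReal_prod_of_nonneg fun _ _ ↦ (Real.exp_pos _).le]

theorem ofReal_exp_le_encard_abs_mulVec_le [DecidableEq κ] {U : Matrix ι κ ℝ} {B : Matrix κ κ ℝ}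
    (hB : |B.det| = 1) (hpos : ∀ n, 0 < ∑ j, U n j ^ 2) (hrow : ∀ n, ∑ j, U n j ^ 2 ≤ 1)
    (hsum : ∑ n, ∑ j, U n j ^ 2 ≤ Fintype.card κ) :
    ENNReal.ofReal (Real.exp (Fintype.card κ / 100)) ≤
      ({a : κ → ℤ | ∀ n, |((U * B) *ᵥ fun k ↦ (a k : ℝ)) n| ≤ √2}.encard : ℝ≥0∞) := by
  have hB₀ : B.det ≠ 0 := abs_ne_zero.1 (hB ▸ one_ne_zero)
  have hcount := lintegral_prod_round_le ((√2)⁻¹ • U) hB₀ fun n ↦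
    (tsum_exp_neg_geomCost (r := (∑ j, U n j ^ 2) / 16) (by linarith [hpos n])
      (by linarith [hrow n])).le
  refine (ofReal_exp_le_lintegral_prod_exp_neg_geomCost hpos hrow hsum).trans
    (hcount.trans_eq ?_)
  simp only [hB, ENNReal.ofReal_one, mul_one, Matrix.smul_mul, smul_mulVec, Pi.smul_apply,
    smul_eq_mul, abs_mul, abs_inv, abs_of_nonneg (Real.sqrt_nonneg 2),
    inv_mul_le_one₀ (Real.sqrt_pos.2 zero_lt_two)]

end LinearForms

section BinomialCombination

/-- The integer-valued polynomial `∑ k < m, a k * (X choose k)`, where `X choose k` is encoded as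
the falling factorial divided by `k !`. -/
noncomputable def binomCombination {m : ℕ} (a : Fin m → ℤ) : ℝ[X] :=
  ∑ k : Fin m, C ((a k : ℝ) / (k : ℕ).factorial) * descPochhammer ℝ k

variable {m : ℕ}

theorem eval_binomCombination (a : Fin m → ℤ) (n : ℕ) :
    (binomCombination a).eval (n : ℝ) = ((∑ k : Fin m, n.choose k * a k : ℤ) : ℝ) := by
  rw [binomCombination, eval_finsetSum, Int.cast_sum]
  refine sum_congr rfl fun k _ ↦ ?_
  rw [eval_mul, eval_C, descPochhammer_eval_eq_descFactorial,
    Nat.descFactorial_eq_factorial_mul_choose]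
  push_cast
  field_simp

theorem isIntegerValued_binomCombination (a : Fin m → ℤ) : IsIntegerValued (binomCombination a) :=
  fun n ↦ ⟨_, eval_binomCombination a n⟩

theorem eval_binomCombination_eq_mulVec (a : Fin m → ℤ) (n : Fin m) :
    (binomCombination a).eval ((n : ℕ) : ℝ) = ((pascalMatrix (1 : ℤ) m *ᵥ a) n : ℤ) := by
  simp only [eval_binomCombination, pascalMatrix, mulVec, dotProduct, of_apply, one_pow, mul_one]

theorem pascalMatrix_mulVec_injective {R : Type*} [CommRing R] (c : R) (m : ℕ) :
    Function.Injective (pascalMatrix c m).mulVec :=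
  mulVec_injective_of_isUnit ((isUnit_iff_isUnit_det _).2 (det_pascalMatrix c m ▸ isUnit_one))

theorem binomCombination_injective :
    Function.Injective (binomCombination : (Fin m → ℤ) → ℝ[X]) := by
  refine fun a b h ↦ pascalMatrix_mulVec_injective 1 m (funext fun n ↦ ?_)
  have heval := congrArg (eval ((n : ℕ) : ℝ)) h
  rwa [eval_binomCombination_eq_mulVec, eval_binomCombination_eq_mulVec, Int.cast_inj] at heval

theorem finite_forall_abs_eval_binomCombination_le (B : ℕ → ℝ) :
    {a : Fin m → ℤ | ∀ n < m, |(binomCombination a).eval (n : ℝ)| ≤ B n}.Finite := by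
  refine ((Set.finite_Icc (fun n : Fin m ↦ -⌊B n⌋) fun n ↦ ⌊B n⌋).preimage
    (pascalMatrix_mulVec_injective 1 m).injOn).subset fun a ha ↦ ?_
  have habs (n : Fin m) : |(pascalMatrix (1 : ℤ) m *ᵥ a) n| ≤ ⌊B n⌋ := by
    rw [Int.le_floor, Int.cast_abs, ← eval_binomCombination_eq_mulVec]
    exact ha n n.2
  exact ⟨fun n ↦ (abs_le.1 (habs n)).1, fun n ↦ (abs_le.1 (habs n)).2⟩

theorem eventually_abs_eval_le_pow (P : ℝ[X]) {r : ℝ} (hr : 1 < r) :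
    ∀ᶠ n : ℕ in Filter.atTop, |P.eval (n : ℝ)| ≤ r ^ n := by
  have hlittle : (fun n : ℕ ↦ P.eval (n : ℝ)) =o[Filter.atTop] fun n : ℕ ↦ r ^ n := by
    simp only [eval_eq_sum_range]
    exact Asymptotics.IsLittleO.fun_sum fun i _ ↦
      (isLittleO_pow_const_const_pow_of_one_lt i hr).const_mul_left _
  filter_upwards [hlittle.bound one_pos] with n hn
  rwa [one_mul, Real.norm_eq_abs, Real.norm_of_nonneg (by positivity)] at hn

theorem exists_forall_lt_imp_forall_abs_eval_binomCombination_le {r : ℝ} (hr : 1 < r)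
    {B : ℕ → ℝ} (hB : ∀ n, r ^ n ≤ B n) (m : ℕ) :
    ∃ N : ℕ, ∀ a : Fin m → ℤ, (∀ n < N, |(binomCombination a).eval (n : ℝ)| ≤ B n) →
      ∀ n : ℕ, |(binomCombination a).eval (n : ℝ)| ≤ B n := by
  obtain ⟨N, hN⟩ := Filter.eventually_atTop.1 <|
    (Filter.eventually_all_finite (finite_forall_abs_eval_binomCombination_le B)).2 fun a _ ↦
      eventually_abs_eval_le_pow (binomCombination (m := m) a) hr
  refine ⟨max m N, fun a ha n ↦ ?_⟩
  rcases lt_or_ge n (max m N) with hn | hn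
  · exact ha n hn
  · exact (hN n (le_of_max_le_right hn) a fun i hi ↦ ha i (lt_max_of_lt_left hi)).trans (hB n)

end BinomialCombination

section GoldenRatio

variable {m : ℕ}

theorem one_sub_inv_goldenRatio_sq : 1 - φ⁻¹ ^ 2 = φ⁻¹ := by
  rw [Real.inv_goldenRatio, neg_sq, Real.goldenConj_sq]
  ring

theorem laguerreMatrix_mul_pascalMatrix_mulVec (a : Fin m → ℤ) {N : ℕ} (n : Fin N) :
    ((laguerreMatrix φ⁻¹ N m * (pascalMatrix φ⁻¹ m)ᵀ) *ᵥ fun k ↦ (a k : ℝ)) n =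
      (binomCombination a).eval ((n : ℕ) : ℝ) / (√φ * φ ^ (n : ℕ)) := by
  rw [laguerreMatrix_mul_transpose_pascalMatrix, one_sub_inv_goldenRatio_sq,
    eval_binomCombination, Int.cast_sum, sum_div, mulVec, dotProduct]
  refine sum_congr rfl fun k _ ↦ ?_
  rw [of_apply, Real.sqrt_inv]
  rcases lt_or_ge (n : ℕ) k with hnk | hnk
  · simp [Nat.choose_eq_zero_of_lt hnk]
  · rw [← pow_add, Nat.sub_add_cancel hnk, inv_pow]
    push_cast
    ring

theorem ofReal_exp_le_encard_abs_eval_binomCombination_le [NeZero m] (N : ℕ) :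
    ENNReal.ofReal (Real.exp (m / 100)) ≤ ({a : Fin m → ℤ | ∀ n < N,
      |(binomCombination a).eval (n : ℝ)| ≤ √(2 * φ) * φ ^ n}.encard : ℝ≥0∞) := by
  have hinv : φ⁻¹ ^ 2 < 1 := by
    have := inv_pos.2 Real.goldenRatio_pos
    linarith [one_sub_inv_goldenRatio_sq]
  have hforms := ofReal_exp_le_encard_abs_mulVec_le (U := laguerreMatrix φ⁻¹ N m)
    (B := (pascalMatrix φ⁻¹ m)ᵀ) (by rw [det_transpose, det_pascalMatrix, abs_one])
    (sum_laguerreMatrix_row_sq_pos (inv_ne_zero Real.goldenRatio_ne_zero) hinv)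
    (sum_laguerreMatrix_row_sq_le hinv.le m)
    ((sum_laguerreMatrix_sq_le hinv.le N m).trans_eq (by rw [Fintype.card_fin]))
  rw [Fintype.card_fin] at hforms
  refine hforms.trans (ENat.toENNReal_mono (Set.encard_le_encard fun a ha n hn ↦ ?_))
  have hden : 0 < √φ * φ ^ n :=
    mul_pos (Real.sqrt_pos.2 Real.goldenRatio_pos) (pow_pos Real.goldenRatio_pos n)
  have hform := ha ⟨n, hn⟩
  rw [laguerreMatrix_mul_pascalMatrix_mulVec, abs_div, abs_of_pos hden, div_le_iff₀ hden] at hform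
  rwa [Real.sqrt_mul zero_le_two, mul_assoc]

theorem ofReal_exp_le_encard_isIntegerValued (m : ℕ) [NeZero m] :
    ENNReal.ofReal (Real.exp (m / 100)) ≤ ({P : ℝ[X] | IsIntegerValued P ∧
      ∀ n : ℕ, |P.eval (n : ℝ)| ≤ √(2 * φ) * φ ^ n}.encard : ℝ≥0∞) := by
  have hsqrt : 1 ≤ √(2 * φ) := Real.one_le_sqrt.2 (by linarith [Real.one_lt_goldenRatio])
  obtain ⟨N, hN⟩ := exists_forall_lt_imp_forall_abs_eval_binomCombination_le
    Real.one_lt_goldenRatio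
    (fun n ↦ le_mul_of_one_le_left (pow_nonneg Real.goldenRatio_pos.le n) hsqrt) m
  refine (ofReal_exp_le_encard_abs_eval_binomCombination_le N).trans (ENat.toENNReal_mono ?_)
  exact Set.encard_le_encard_of_injOn
    (fun a ha ↦ ⟨isIntegerValued_binomCombination a, hN a ha⟩) binomCombination_injective.injOn

end GoldenRatio

theorem theorem1_general :
    {P : ℝ[X] | IsIntegerValued P ∧
      ∀ n : ℕ, |P.eval (n : ℝ)| ≤ √(2 * φ) * φ ^ n}.Infinite := by
  intro hfin
  obtain ⟨m, hm⟩ := exists_nat_gt (100 * (hfin.toFinset.card : ℝ))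
  have : NeZero m := ⟨by rintro rfl; exact hm.not_ge (by simp)⟩
  have hcard := ofReal_exp_le_encard_isIntegerValued m
  rw [hfin.encard_eq_coe_toFinset_card, ENat.toENNReal_coe, ← ENNReal.ofReal_natCast,
    ENNReal.ofReal_le_ofReal_iff (Nat.cast_nonneg _)] at hcard
  linarith [Real.add_one_le_exp ((m : ℝ) / 100)]

theorem theorem1 (ε : ℝ) (hε : 0 < ε) :
    {P : Polynomial ℝ | IsIntegerValued P ∧
      ∀ n : ℕ, |P.eval (n : ℝ)| ≤
        (Real.sqrt (2 * Real.goldenRatio) + ε) * Real.goldenRatio ^ n}.Infinite :=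
  theorem1_general.mono fun _ hP ↦ ⟨hP.1, fun n ↦ (hP.2 n).trans <| by gcongr; linarith⟩
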